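/- Let $k$ be a field, let $R=k[x,y,z]$ with the standard grading, and let $n\ge 4$. Let $J\subseteq R$ be an ideal satisfying $(\star)$: $J$ has grade $3$, and $R/J$ has the graded Betti numbers of a minimal graded free resolution of the form $$0\to R(-(2n+4))\oplus R(-(2n+7))\oplus R(-(3n+5))\to R(-(n+2))^2\oplus R(-(n+4))\oplus R(-(2n+3))\oplus R(-(2n+6))^2\oplus R(-(3n+4))\to R(-2)\oplus R(-(n+1))^2\oplus R(-(n+3))\oplus R(-(2n+4))\to R\to R/J\to 0 .$$ The type of a complete intersection generated by a regular sequence of forms $f_1,\dots,f_g$ with $\deg f_1\le\dots\le\deg f_g$ is $(\deg f_1,\dots,\deg f_g)$; types are compared componentwise. Two proper ideals $I,I'$ are directly linked by $C$, written $I\overset{C}{\sim}I'$, if $I'=C:I$ and $I=C:I'$. A homogeneous perfect ideal $I$ is sequentially bounded licci if there is a chain of direct links $I=I_0\overset{C_0}{\sim}I_1\overset{C_1}{\sim}\cdots\overset{C_{s-1}}{\sim}I_s$, where every $C_i$ is a homogeneous complete intersection, $I_s$ is a homogeneous complete intersection, and $\mathrm{type}(C_i)\ge \mathrm{type}(C_{i+1})$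 for $0\le i\le s-2$. Consider the monomial ideal $$J'=(x^2,\;y^{2n+1},\;z^{2n+4},\;y^nz,\;xy^{n-1}z,\;xyz^{n+1}).$$ Then $J'$ is sequentially bounded licci; more precisely, $J'$ is homogeneous and perfect, and there are monomial ideals $J_1',J_2',J_3'$ that form with it a sequentially bounded chain of direct links $$J'\overset{(x^2,y^{2n+1},z^{2n+4})}{\sim}J_1'\overset{(x^2,y^{2n},z^{2n+3})}{\sim}J_2'\overset{(x^2,y^{n-1},z^{2n+3})}{\sim}J_3'\overset{(x,y^{n-1},z^{2n+3})}{\sim}(x,y^{n-2},z^n).$$ Moreover $J'$ has the same Hilbert function as $J$: $\dim_k(R/J')_j=\dim_k(R/J)_j$ for all $j\ge 0$. -/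

import Mathlib

open MvPolynomial

attribute [local instance] MvPolynomial.gradedAlgebra

/-- The grade of an ideal `I`: the supremum of the lengths of the `R`-regular sequences whose
entries lie in `I`. -/
noncomputable def idealGrade {R : Type*} [CommRing R] (I : Ideal R) : ℕ∞ :=
  ⨆ rs : {rs : List R // RingTheory.Sequence.IsRegular R rs ∧ ∀ r ∈ rs, r ∈ I},
    (rs.1.length : ℕ∞)

/-- The ideal `I` is perfect: the projective dimension of `R / I` equals the grade of `I`.
(The unit ideal is not perfect, since the zero module has projective dimension `⊥`.) -/
def IsPerfectIdeal {R : Type*} [CommRing R] (I : Ideal R) : Prop :=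
  CategoryTheory.projectiveDimension (ModuleCat.of R (R ⧸ I)) =
    ((idealGrade I : ℕ∞) : WithBot ℕ∞)

/-- The proper ideals `I` and `J` are directly linked by the ideal `C`:
`J = C : I` and `I = C : J`. -/
def IsDirectlyLinkedBy {R : Type*} [CommRing R] (C I J : Ideal R) : Prop :=
  I ≠ ⊤ ∧ J ≠ ⊤ ∧ J = Submodule.colon C (I : Set R) ∧ I = Submodule.colon C (J : Set R)

/-- `C` is a homogeneous complete intersection of type `t = (d₁ ≤ ⋯ ≤ d_g)`: it is generated by a
regular sequence `f₁, …, f_g` of forms with `deg f_i = d_i`. -/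
def IsHomogeneousCI {σ k : Type*} [Field k] (C : Ideal (MvPolynomial σ k)) (t : List ℕ) : Prop :=
  ∃ fs : List (MvPolynomial σ k),
    RingTheory.Sequence.IsRegular (MvPolynomial σ k) fs ∧
    List.Forall₂ (fun (f : MvPolynomial σ k) (d : ℕ) => f.IsHomogeneous d) fs t ∧
    t.Pairwise (· ≤ ·) ∧
    C = Ideal.ofList fs

/-- `L 0 ∼ L 1 ∼ ⋯ ∼ L s` is a sequentially bounded chain of links to a complete intersection:
`L i` and `L (i+1)` are directly linked by the homogeneous complete intersection `C i` of type
`t i`, the types satisfy `t i ≥ t (i+1)` componentwise, and `L s` is a homogeneous complete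
intersection. -/
def IsSequentiallyBoundedChain {σ k : Type*} [Field k] (s : ℕ)
    (L : Fin (s + 1) → Ideal (MvPolynomial σ k)) (C : Fin s → Ideal (MvPolynomial σ k))
    (t : Fin s → List ℕ) : Prop :=
  (∀ i : Fin s, IsHomogeneousCI (C i) (t i) ∧
    IsDirectlyLinkedBy (C i) (L i.castSucc) (L i.succ)) ∧
  (∀ i j : Fin s, (i : ℕ) + 1 = j → List.Forall₂ (· ≥ ·) (t i) (t j)) ∧
  ∃ u : List ℕ, IsHomogeneousCI (L (Fin.last s)) u

/-- The ideal `I` is sequentially bounded licci (SBL): it is homogeneous and perfect, and it is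
linked to a homogeneous complete intersection by a sequentially bounded chain. -/
def IsSequentiallyBoundedLicci {σ k : Type*} [Field k] (I : Ideal (MvPolynomial σ k)) : Prop :=
  I.IsHomogeneous (homogeneousSubmodule σ k) ∧ IsPerfectIdeal I ∧
  ∃ (s : ℕ) (L : Fin (s + 1) → Ideal (MvPolynomial σ k))
    (C : Fin s → Ideal (MvPolynomial σ k)) (t : Fin s → List ℕ),
    L 0 = I ∧ IsSequentiallyBoundedChain s L C t

/-- A minimal graded free resolution
`⋯ → F₃ → F₂ → F₁ → R → R / I → 0`, `R = k[σ]` with the standard grading,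
with `F_{i+1} = ⨁ₐ R(-shift i a)`, `a : Fin (rank i)`. The map `F₁ → R` is the row `gen` of
generators of `I`, and `F_{i+2} → F_{i+1}` is the matrix `diff i`. -/
structure MinimalGradedFreeResolution {σ k : Type*} [Field k]
    (I : Ideal (MvPolynomial σ k)) where
  rank : ℕ → ℕ
  shift : (i : ℕ) → Fin (rank i) → ℕ
  gen : Fin (rank 0) → MvPolynomial σ k
  diff : (i : ℕ) → Matrix (Fin (rank i)) (Fin (rank (i + 1))) (MvPolynomial σ k)
  /-- the maps are homogeneous of degree zero -/
  gen_homogeneous : ∀ a, (gen a).IsHomogeneous (shift 0 a)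
  diff_homogeneous : ∀ i a b, diff i a b = 0 ∨
    ∃ d : ℕ, shift i a + d = shift (i + 1) b ∧ (diff i a b).IsHomogeneous d
  /-- minimality: all entries lie in the homogeneous maximal ideal -/
  gen_minimal : ∀ a, constantCoeff (gen a) = 0
  diff_minimal : ∀ i a b, constantCoeff (diff i a b) = 0
  /-- exactness at `R`, at `F₁`, and at `F_{i+2}` -/
  span_gen : Ideal.span (Set.range gen) = I
  exact_zero : ∀ v : Fin (rank 0) → MvPolynomial σ k,
    ∑ a, v a * gen a = 0 ↔ ∃ w, (diff 0).mulVec w = v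
  exact_succ : ∀ (i : ℕ) (v : Fin (rank (i + 1)) → MvPolynomial σ k),
    (diff i).mulVec v = 0 ↔ ∃ w, (diff (i + 1)).mulVec w = v

/-- The number of summands `R(-j)` in homological degree `i` of the resolution of `R / I`. -/
def MinimalGradedFreeResolution.betti {σ k : Type*} [Field k] {I : Ideal (MvPolynomial σ k)}
    (F : MinimalGradedFreeResolution I) : ℕ → ℕ → ℕ
  | 0, j => if j = 0 then 1 else 0
  | i + 1, j => (Finset.univ.filter fun a => F.shift i a = j).card

/-- The graded Betti numbers of `R / I` are `β i j`. (A minimal graded free resolution is unique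
up to isomorphism, so its choice does not matter.) -/
def HasGradedBettiNumbers {σ k : Type*} [Field k] (I : Ideal (MvPolynomial σ k))
    (β : ℕ → ℕ → ℕ) : Prop :=
  ∃ F : MinimalGradedFreeResolution I, ∀ i j, F.betti i j = β i j

/-- The shifts, with multiplicity, in homological degrees `0, 1, 2, 3, …` of the resolution that
defines the property `(⋆)`. -/
def starShifts (n : ℕ) : ℕ → Multiset ℕ
  | 0 => {0}
  | 1 => {2, n + 1, n + 1, n + 3, 2 * n + 4}
  | 2 => {n + 2, n + 2, n + 4, 2 * n + 3, 2 * n + 6, 2 * n + 6, 3 * n + 4}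
  | 3 => {2 * n + 4, 2 * n + 7, 3 * n + 5}
  | _ => 0

/-- The property `(⋆)`: the ideal has grade `3` and the prescribed Betti table. -/
def SatisfiesStar {σ k : Type*} [Field k] (n : ℕ) (J : Ideal (MvPolynomial σ k)) : Prop :=
  idealGrade J = 3 ∧ HasGradedBettiNumbers J fun i j => (starShifts n i).count j

/-- The Hilbert function `j ↦ dim_k (R / I)_j`, where `(R / I)_j` is the image of the space of
forms of degree `j`. -/
noncomputable def hilbertFun {σ k : Type*} [Field k] (I : Ideal (MvPolynomial σ k)) (j : ℕ) : ℕ :=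
  Module.finrank k
    ((homogeneousSubmodule σ k j).map (Ideal.Quotient.mkₐ k I).toLinearMap)

/-- A monomial ideal: one generated by monomials. -/
def IsMonomialIdeal {σ k : Type*} [Field k] (I : Ideal (MvPolynomial σ k)) : Prop :=
  ∃ S : Set (σ →₀ ℕ), I = Ideal.span ((fun m => monomial m (1 : k)) '' S)

/-- The ideal `(x^a, y^b, z^c)` of `k[x, y, z]`. -/
noncomputable def purePowers (k : Type*) [Field k] (a b c : ℕ) : Ideal (MvPolynomial (Fin 3) k) :=
  Ideal.span {X 0 ^ a, X 1 ^ b, X 2 ^ c}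

/-- The ideal `(x², y^{2n+1}, z^{2n+4}, yⁿz, xy^{n-1}z, xyz^{n+1})` of `k[x, y, z]`. -/
noncomputable def starMonomialIdeal (k : Type*) [Field k] (n : ℕ) :
    Ideal (MvPolynomial (Fin 3) k) :=
  Ideal.span {X 0 ^ 2, X 1 ^ (2 * n + 1), X 2 ^ (2 * n + 4), X 1 ^ n * X 2,
    X 0 * X 1 ^ (n - 1) * X 2, X 0 * X 1 * X 2 ^ (n + 1)}

/-! Three independent arguments are combined. Links: let `C` be generated by pure powers of x, y, z,
so that the monomials outside `C` fill a box. For a monomial ideal `I`, the standard monomials of `C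
: I` are the images of the monomials of `I` in the box under the half-turn of the box. Each link
thus becomes a statement about inequalities between exponents (`isDirectlyLinkedBy_monomialSpan`),
which is decidable linear arithmetic. Perfection: J' contains powers of all the variables. A prime
filtration of R/J' has only the residue field of the origin as a factor, and the Koszul bound for
that field gives projective dimension at most 3. The three pure powers form a regular sequence in
J', so vanishing of Ext below degree 3 gives the opposite bound (`isPerfectIdeal_of_isRegular`).
Hilbert function: (⋆) determines (1 - X)^3 times the Hilbert series of R/J as the alternating sum of
the X^shift. For J' the standard monomials are cut into boxes, whose series are products of
geometric sums; the numerator turns out to be the same. -/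

open CategoryTheory CategoryTheory.Abelian RingTheory.Sequence

universe u

/-! ### Projective dimension, grade and perfection -/

section ProjectiveDimension

variable {R : Type u} [CommRing R]

/-- The quotient by a weakly regular sequence of length `n` raises a bound on the projective
dimension by at most `n`. -/
theorem hasProjectiveDimensionLT_quotient_of_isWeaklyRegular (rs : List R) :
    ∀ (M : Type u) [AddCommGroup M] [Module R M] (d : ℕ),
      HasProjectiveDimensionLT (ModuleCat.of R M) (d + 1) → IsWeaklyRegular M rs →
      HasProjectiveDimensionLT
        (ModuleCat.of R (M ⧸ (Ideal.ofList rs • ⊤ : Submodule R M))) (d + 1 + rs.length) := by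
  induction rs with
  | nil =>
    intro M _ _ d hM _
    refine hasProjectiveDimensionLT_of_iso (LinearEquiv.toModuleIso
      (Submodule.quotEquivOfEqBot _ ?_).symm) _ (X := ModuleCat.of R M)
    simp
  | cons r rs ih =>
    intro M _ _ d hM h
    rw [isWeaklyRegular_cons_iff] at h
    -- The sequence 0 → M → M → M/rM → 0 raises the bound by one.
    have h1 : HasProjectiveDimensionLT (ModuleCat.of R (QuotSMulTop r M)) (d + 1 + 1) :=
      (IsSMulRegular.smulShortComplex_shortExact (M := ModuleCat.of R M)
        h.1).hasProjectiveDimensionLT_X₃ (d + 1) hM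
          (hasProjectiveDimensionLT_of_ge (ModuleCat.of R M) (d + 1) _ (Nat.le_succ _))
    have h2 := ih (QuotSMulTop r M) (d + 1) h1 h.2
    have h3 := hasProjectiveDimensionLT_of_iso (LinearEquiv.toModuleIso
      (Submodule.quotOfListConsSMulTopEquivQuotSMulTopInner M r rs).symm) (d + 1 + 1 + rs.length)
    convert! h3 using 1
    simp only [List.length_cons]
    omega

theorem hasProjectiveDimensionLT_quotient_ofList {rs : List R} (h : IsWeaklyRegular R rs) :
    HasProjectiveDimensionLT (ModuleCat.of R (R ⧸ Ideal.ofList rs)) (rs.length + 1) := by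
  have h0 : HasProjectiveDimensionLT (ModuleCat.of R R) (0 + 1) := by
    rw [zero_add]; infer_instance
  have h1 := hasProjectiveDimensionLT_quotient_of_isWeaklyRegular rs R 0 h0 h
  have h2 := hasProjectiveDimensionLT_of_iso (LinearEquiv.toModuleIso
    (Submodule.quotEquivOfEq (Ideal.ofList rs • ⊤ : Submodule R R) (Ideal.ofList rs)
      (by simp))) (0 + 1 + rs.length)
  rwa [zero_add, add_comm] at h2

/-- If a weakly regular sequence of length `d` generates a maximal ideal `𝔪`, every finitely
generated module that is annihilated by an ideal whose radical contains `𝔪` has projective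
dimension at most `d`. -/
theorem hasProjectiveDimensionLT_of_annihilator [IsNoetherianRing R] {rs : List R}
    (h : IsWeaklyRegular R rs) (hmax : (Ideal.ofList rs).IsMaximal) {I : Ideal R}
    (hI : Ideal.ofList rs ≤ I.radical) (M : Type u) [AddCommGroup M] [Module R M]
    [hfin : Module.Finite R M] (hM : I ≤ Module.annihilator R M) :
    HasProjectiveDimensionLT (ModuleCat.of R M) (rs.length + 1) := by
  revert hM
  -- Dévissage along a prime filtration. The annihilator condition is part of the induction claim,
  -- since it passes to submodules and quotients.
  induction hfin using IsNoetherianRing.induction_on_isQuotientEquivQuotientPrime R with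
  | subsingleton N =>
    intro _
    have := (ModuleCat.isZero_of_subsingleton (ModuleCat.of R N)).hasProjectiveDimensionLT_zero
    exact hasProjectiveDimensionLT_of_ge _ 0 _ (Nat.zero_le _)
  | quotient N p e =>
    intro hN
    rw [e.annihilator_eq, Ideal.annihilator_quotient] at hN
    -- A prime containing `I` contains its radical, hence the maximal ideal, and so equals it.
    have hp : Ideal.ofList rs = p.1 :=
      hmax.eq_of_le p.2.ne_top (hI.trans (p.2.radical_le_iff.2 hN))
    have := hasProjectiveDimensionLT_quotient_ofList h
    exact hasProjectiveDimensionLT_of_iso (LinearEquiv.toModuleIso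
      ((Submodule.quotEquivOfEq _ _ hp).trans e.symm)) _
  | exact N₁ N₂ N₃ f g hf hg hfg h₁ h₃ =>
    intro hN
    have hS : (ModuleCat.shortComplexOfCompEqZero f g hfg.linearMap_comp_eq_zero).ShortExact :=
      { exact := ModuleCat.shortComplex_exact _ hfg
        mono_f := by simpa [ModuleCat.mono_iff_injective] using! hf
        epi_g := by simpa [ModuleCat.epi_iff_surjective] using! hg }
    exact hS.hasProjectiveDimensionLT_X₂ _
      (h₁ (hN.trans (f.annihilator_le_of_injective hf)))
      (h₃ (hN.trans (g.annihilator_le_of_surjective hg)))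

theorem isWeaklyRegular_pi {rs : List R} (h : IsWeaklyRegular R rs) (ι : Type*) [Finite ι] :
    IsWeaklyRegular (ι → R) rs :=
  ((TensorProduct.rid R (ι → R)).isWeaklyRegular_congr rs).1 h.isWeaklyRegular_lTensor

/-- If a proper ideal `I` contains a regular sequence of length `d`, the projective dimension of
`R / I` is at least `d`. -/
theorem not_hasProjectiveDimensionLT_of_isRegular [IsNoetherianRing R] {I : Ideal R}
    (hI : I ≠ ⊤) {rs : List R} (h : IsRegular R rs) (hrs : ∀ r ∈ rs, r ∈ I) :
    ¬ HasProjectiveDimensionLT (ModuleCat.of R (R ⧸ I)) rs.length := by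
  intro hpd
  -- If the projective dimension were smaller than the length, all Ext^i(R/I, N) with `N` finite
  -- would vanish, by descending induction on `i`; here `j` bounds the distance from `i` up to the
  -- length.
  have hvan : ∀ j i : ℕ, rs.length ≤ i + j → ∀ N : ModuleCat.{u} R, Module.Finite R N →
      Subsingleton (Ext (ModuleCat.of R (R ⧸ I)) N i) := by
    intro j
    induction j with
    | zero => exact fun i hi N _ => HasProjectiveDimensionLT.subsingleton _ rs.length i hi N
    | succ j ih =>
      intro i hi N _
      by_cases hi' : rs.length ≤ i
      · exact HasProjectiveDimensionLT.subsingleton _ rs.length i hi' N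
      push Not at hi'
      obtain ⟨n, f, hf⟩ := Module.Finite.exists_fin' R N
      -- One superfluous coordinate keeps the free module nonzero even for n = 0, as needed for `I •
      -- ⊤ ≠ ⊤`.
      let f' : (Fin (n + 1) → R) →ₗ[R] N := f ∘ₗ LinearMap.funLeft R R Fin.castSucc
      have hf' : Function.Surjective f' :=
        hf.comp (LinearMap.funLeft_surjective_of_injective R R _ (Fin.castSucc_injective n))
      have hS := LinearMap.shortExact_shortComplexKer hf'
      have h2 : Subsingleton (Ext (ModuleCat.of R (R ⧸ I))
          (ModuleCat.of R (Fin (n + 1) → R)) i) := by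
        have hne : (⊤ : Submodule R (Fin (n + 1) → R)) ≠ I • ⊤ := by
          intro htop
          have h0 := congrArg (Submodule.map (LinearMap.proj (R := R) (φ := fun _ => R) 0)) htop
          rw [Submodule.map_smul'', Submodule.map_top,
            LinearMap.range_eq_top.2 (LinearMap.proj_surjective _)] at h0
          exact hI (by simpa using h0.symm)
        refine ModuleCat.subsingleton_ext_of_exists_isRegular I (ModuleCat.of R (R ⧸ I)) ?_
          (ModuleCat.of R (Fin (n + 1) → R)) hne.symm.lt_top rs hrs
          ⟨isWeaklyRegular_pi h.1 _, fun htop => hne (top_le_iff.1 ?_).symm⟩ i hi'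
        · rw [Module.support_eq_zeroLocus, Ideal.annihilator_quotient]
        · exact htop.le.trans (Submodule.smul_mono_left (Ideal.span_le.2 hrs))
      have h3 := ih (i + 1) (by omega) (f'.shortComplexKer).X₁
        (inferInstanceAs (Module.Finite R (LinearMap.ker f')))
      have z1 := AddCommGrpCat.isZero_of_iff_subsingleton.mpr h2
      have z2 := AddCommGrpCat.isZero_of_iff_subsingleton.mpr h3
      exact AddCommGrpCat.subsingleton_of_isZero <| ShortComplex.Exact.isZero_of_both_zeros
        ((Ext.covariant_sequence_exact₃' _ hS) i (i + 1) rfl)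
        (z1.eq_zero_of_src _) (z2.eq_zero_of_tgt _)
  -- In degree 0 with N = R/I, the identity of R/I would be zero.
  have := hvan rs.length 0 (by simp) (ModuleCat.of R (R ⧸ I)) inferInstance
  have h0 : Subsingleton (ModuleCat.of R (R ⧸ I) ⟶ ModuleCat.of R (R ⧸ I)) :=
    Ext.homEquiv₀.symm.subsingleton
  have hz := (Limits.IsZero.iff_id_eq_zero (ModuleCat.of R (R ⧸ I))).2 (Subsingleton.elim _ _)
  rw [ModuleCat.isZero_iff_subsingleton] at hz
  exact hI (Submodule.Quotient.subsingleton_iff.1 hz)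

/-- Suppose that a weakly regular sequence of length `d` generates a maximal ideal `𝔪`. A proper
ideal whose radical contains `𝔪`, and which contains a regular sequence of length `d`, is
perfect. -/
theorem isPerfectIdeal_of_isRegular [IsNoetherianRing R] {rs fs : List R}
    (h : IsWeaklyRegular R rs) (hmax : (Ideal.ofList rs).IsMaximal) {I : Ideal R} (hI : I ≠ ⊤)
    (hrad : Ideal.ofList rs ≤ I.radical) (hfs : IsRegular R fs) (hfI : ∀ f ∈ fs, f ∈ I)
    (hlen : fs.length = rs.length) : IsPerfectIdeal I := by
  have hle : HasProjectiveDimensionLT (ModuleCat.of R (R ⧸ I)) (rs.length + 1) :=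
    hasProjectiveDimensionLT_of_annihilator h hmax hrad (R ⧸ I) Ideal.annihilator_quotient.ge
  have hgrade : idealGrade I = rs.length := by
    refine le_antisymm (iSup_le fun gs => ?_) ?_
    · by_contra! hlt
      have hlt' : rs.length + 1 ≤ gs.1.length := by exact_mod_cast hlt
      exact not_hasProjectiveDimensionLT_of_isRegular hI gs.2.1 gs.2.2
        (hasProjectiveDimensionLT_of_ge _ _ _ hlt')
    · rw [← hlen]
      exact le_iSup (fun gs : {gs : List R // IsRegular R gs ∧ ∀ r ∈ gs, r ∈ I} =>
        (gs.1.length : ℕ∞)) ⟨fs, hfs, hfI⟩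
  rw [IsPerfectIdeal, hgrade]
  refine le_antisymm ?_ ?_
  · exact (projectiveDimension_le_iff _ _).2 hle
  · refine (projectiveDimension_ge_iff _ _).2 ?_
    rw [← hlen]
    exact not_hasProjectiveDimensionLT_of_isRegular hI hfs hfI

end ProjectiveDimension

/-! ### Monomial ideals, their colons and links -/

section MonomialIdeals

variable {σ : Type*} (k : Type*) [Field k]

/-- The ideal generated by the monomials with exponents in `S`. -/
noncomputable def monomialSpan (S : Set (σ →₀ ℕ)) : Ideal (MvPolynomial σ k) :=
  Ideal.span ((fun m => monomial m (1 : k)) '' S)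

variable {k}

theorem isMonomialIdeal_monomialSpan (S : Set (σ →₀ ℕ)) : IsMonomialIdeal (monomialSpan k S) :=
  ⟨S, rfl⟩

theorem mem_monomialSpan {S : Set (σ →₀ ℕ)} {p : MvPolynomial σ k} :
    p ∈ monomialSpan k S ↔ ∀ e ∈ p.support, ∃ s ∈ S, s ≤ e :=
  mem_ideal_span_monomial_image

theorem monomial_mem_monomialSpan {S : Set (σ →₀ ℕ)} {e : σ →₀ ℕ} :
    monomial e (1 : k) ∈ monomialSpan k S ↔ ∃ s ∈ S, s ≤ e := by
  classical
  rw [mem_monomialSpan, support_monomial, if_neg one_ne_zero]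
  simp

/-- Multiplication by a monomial translates the support. Colons and regularity thereby reduce to
exponents. -/
theorem mul_monomial_mem_monomialSpan {S : Set (σ →₀ ℕ)} {p : MvPolynomial σ k} {m : σ →₀ ℕ} :
    p * monomial m 1 ∈ monomialSpan k S ↔ ∀ e ∈ p.support, ∃ s ∈ S, s ≤ e + m := by
  rw [mem_monomialSpan]
  constructor
  · intro h e he
    refine h (e + m) ?_
    rw [mem_support_iff] at he ⊢
    rwa [coeff_mul_monomial, mul_one]
  · intro h e he
    rw [mem_support_iff, coeff_mul_monomial'] at he
    split_ifs at he with hle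
    · rw [mul_one, ← mem_support_iff] at he
      simpa [tsub_add_cancel_of_le hle] using h _ he
    · exact absurd rfl he

theorem monomialSpan_ne_top {S : Set (σ →₀ ℕ)} (h : 0 ∉ S) : monomialSpan k S ≠ ⊤ := by
  rw [Ne, Ideal.eq_top_iff_one]
  intro h1
  obtain ⟨s, hs, hs0⟩ := monomial_mem_monomialSpan.1 h1
  rw [nonpos_iff_eq_zero.1 hs0] at hs
  exact h hs

theorem isHomogeneous_monomialSpan (S : Set (σ →₀ ℕ)) :
    (monomialSpan k S).IsHomogeneous (homogeneousSubmodule σ k) := by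
  refine Ideal.homogeneous_span _ _ ?_
  rintro _ ⟨m, -, rfl⟩
  exact ⟨m.degree, isHomogeneous_monomial _ rfl⟩

/-- A colon ideal of monomial ideals is the monomial ideal of the exponents that it should
contain. -/
theorem colon_monomialSpan {S T U : Set (σ →₀ ℕ)}
    (h : ∀ e, (∃ u ∈ U, u ≤ e) ↔ ∀ t ∈ T, ∃ s ∈ S, s ≤ e + t) :
    monomialSpan k U = Submodule.colon (monomialSpan k S) (monomialSpan k T : Set _) := by
  ext p
  rw [monomialSpan, monomialSpan, monomialSpan, Ideal.colon_span, Submodule.mem_colon]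
  simp only [Set.forall_mem_image, smul_eq_mul]
  change p ∈ monomialSpan k U ↔ ∀ t, t ∈ T → p * monomial t 1 ∈ monomialSpan k S
  simp only [mul_monomial_mem_monomialSpan]
  rw [mem_monomialSpan]
  simp only [h]
  exact ⟨fun H t ht e he => H e he t ht, fun H e he t ht => H t ht e he⟩

theorem isDirectlyLinkedBy_monomialSpan {S T U : Set (σ →₀ ℕ)} (hT : 0 ∉ T) (hU : 0 ∉ U)
    (h : ∀ e, (∃ u ∈ U, u ≤ e) ↔ ∀ t ∈ T, ∃ s ∈ S, s ≤ e + t)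
    (h' : ∀ e, (∃ t ∈ T, t ≤ e) ↔ ∀ u ∈ U, ∃ s ∈ S, s ≤ e + u) :
    IsDirectlyLinkedBy (monomialSpan k S) (monomialSpan k T) (monomialSpan k U) :=
  ⟨monomialSpan_ne_top hT, monomialSpan_ne_top hU, colon_monomialSpan h, colon_monomialSpan h'⟩

theorem isSMulRegular_quotient_monomialSpan {S : Set (σ →₀ ℕ)} {m : σ →₀ ℕ}
    (h : ∀ e, (∃ s ∈ S, s ≤ e + m) → ∃ s ∈ S, s ≤ e) :
    IsSMulRegular (MvPolynomial σ k ⧸ monomialSpan k S) (monomial m (1 : k)) := by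
  rw [isSMulRegular_quotient_iff_mem_of_smul_mem]
  intro p hp
  rw [smul_eq_mul, mul_comm, mul_monomial_mem_monomialSpan] at hp
  exact mem_monomialSpan.2 fun e he => h e (hp e he)

end MonomialIdeals

/-! ### Three variables: pure powers, perfection of J', the chain of links -/

section ThreeVariables

variable {k : Type*} [Field k]

/-- The exponent of the monomial `x^a y^b z^c`. -/
noncomputable def expo (a b c : ℕ) : Fin 3 →₀ ℕ := Finsupp.equivFunOnFinite.symm ![a, b, c]

@[simp] theorem expo_apply_zero (a b c : ℕ) : expo a b c 0 = a := rfl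
@[simp] theorem expo_apply_one (a b c : ℕ) : expo a b c 1 = b := rfl
@[simp] theorem expo_apply_two (a b c : ℕ) : expo a b c 2 = c := rfl

theorem expo_le_iff {a b c : ℕ} {e : Fin 3 →₀ ℕ} :
    expo a b c ≤ e ↔ a ≤ e 0 ∧ b ≤ e 1 ∧ c ≤ e 2 := by
  rw [Finsupp.le_def, Fin.forall_fin_succ, Fin.forall_fin_two]
  rfl

theorem zero_eq_expo_iff {a b c : ℕ} : 0 = expo a b c ↔ a = 0 ∧ b = 0 ∧ c = 0 := by
  rw [eq_comm, Finsupp.ext_iff, Fin.forall_fin_succ, Fin.forall_fin_two]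
  rfl

theorem monomial_expo (a b c : ℕ) :
    monomial (expo a b c) (1 : k) = X 0 ^ a * X 1 ^ b * X 2 ^ c := by
  rw [monomial_eq, Finsupp.prod_fintype _ _ (by simp), Fin.prod_univ_three]
  simp

theorem purePowers_eq (a b c : ℕ) :
    purePowers k a b c = monomialSpan k {expo a 0 0, expo 0 b 0, expo 0 0 c} := by
  simp [purePowers, monomialSpan, Set.image_insert_eq, monomial_expo]

theorem starMonomialIdeal_eq (n : ℕ) :
    starMonomialIdeal k n = monomialSpan k {expo 2 0 0, expo 0 (2 * n + 1) 0,
      expo 0 0 (2 * n + 4), expo 0 n 1, expo 1 (n - 1) 1, expo 1 1 (n + 1)} := by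
  simp [starMonomialIdeal, monomialSpan, Set.image_insert_eq, monomial_expo]

theorem ofList_purePowers (a b c : ℕ) :
    Ideal.ofList [(X 0 : MvPolynomial (Fin 3) k) ^ a, X 1 ^ b, X 2 ^ c] =
      purePowers k a b c := by
  simp only [purePowers, Ideal.ofList]
  congr 1
  ext; simp

theorem purePowers_ne_top {a b c : ℕ} (ha : a ≠ 0) (hb : b ≠ 0) (hc : c ≠ 0) :
    purePowers k a b c ≠ ⊤ := by
  rw [purePowers_eq]
  exact monomialSpan_ne_top (by simp [zero_eq_expo_iff, ha, hb, hc])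

/-- A power of a new variable does not affect divisibility by powers of the earlier ones, so it is a
nonzerodivisor modulo them. -/
theorem isRegular_purePowers {a b c : ℕ} (ha : a ≠ 0) (hb : b ≠ 0) (hc : c ≠ 0) :
    IsRegular (MvPolynomial (Fin 3) k)
      [(X 0 : MvPolynomial (Fin 3) k) ^ a, X 1 ^ b, X 2 ^ c] := by
  have h0 : (X 0 : MvPolynomial (Fin 3) k) ^ a = monomial (expo a 0 0) 1 := by
    simp [monomial_expo]
  have h1 : (X 1 : MvPolynomial (Fin 3) k) ^ b = monomial (expo 0 b 0) 1 := by
    simp [monomial_expo]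
  have h2 : (X 2 : MvPolynomial (Fin 3) k) ^ c = monomial (expo 0 0 c) 1 := by
    simp [monomial_expo]
  have key : ∀ (rs : List (MvPolynomial (Fin 3) k)) (S : Set (Fin 3 →₀ ℕ)) (m : Fin 3 →₀ ℕ),
      Ideal.ofList rs = monomialSpan k S → (∀ e, (∃ s ∈ S, s ≤ e + m) → ∃ s ∈ S, s ≤ e) →
      IsSMulRegular (MvPolynomial (Fin 3) k ⧸
        (Ideal.ofList rs • ⊤ : Submodule (MvPolynomial (Fin 3) k) (MvPolynomial (Fin 3) k)))
        (monomial m (1 : k)) := by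
    intro rs S m hrs h
    rw [smul_eq_mul, Ideal.mul_top, hrs]
    exact isSMulRegular_quotient_monomialSpan h
  refine ⟨⟨fun i hi => ?_⟩, ?_⟩
  · have hi3 : i < 3 := hi
    interval_cases i
    · simp only [List.take_zero, List.getElem_cons_zero, h0]
      exact key [] ∅ _ (by simp [monomialSpan]) (by simp)
    · simp only [List.take_succ_cons, List.take_zero, List.getElem_cons_succ,
        List.getElem_cons_zero, h1]
      refine key _ {expo a 0 0} _ (by simp [monomialSpan, monomial_expo]) ?_
      simp [expo_le_iff]
    · simp only [List.take_succ_cons, List.take_zero, List.getElem_cons_succ,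
        List.getElem_cons_zero, h2]
      refine key _ {expo a 0 0, expo 0 b 0} _ ?_ ?_
      · simp [monomialSpan, monomial_expo, Set.image_insert_eq, Ideal.span_insert]
      · simp [expo_le_iff]
  · rw [smul_eq_mul, Ideal.mul_top, ofList_purePowers]
    exact (purePowers_ne_top ha hb hc).symm

theorem isHomogeneousCI_purePowers {a b c : ℕ} (ha : a ≠ 0) (hab : a ≤ b) (hbc : b ≤ c) :
    IsHomogeneousCI (purePowers k a b c) [a, b, c] := by
  refine ⟨_, isRegular_purePowers ha (by omega) (by omega), ?_, ?_, (ofList_purePowers a b c).symm⟩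
  · simp only [List.forall₂_cons, List.Forall₂.nil, and_true]
    exact ⟨isHomogeneous_X_pow _ _, isHomogeneous_X_pow _ _, isHomogeneous_X_pow _ _⟩
  · simp; omega

/-- The ideal is the kernel of the surjection `constantCoeff` onto `k`. The exponents 1 are kept so
that the results on pure powers apply. -/
theorem isMaximal_ofList_variables :
    (Ideal.ofList [(X 0 : MvPolynomial (Fin 3) k) ^ 1, X 1 ^ 1, X 2 ^ 1]).IsMaximal := by
  have h : Ideal.ofList [(X 0 : MvPolynomial (Fin 3) k) ^ 1, X 1 ^ 1, X 2 ^ 1] =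
      RingHom.ker (constantCoeff (σ := Fin 3) (R := k)) := by
    rw [ofList_purePowers, purePowers_eq]
    ext p
    rw [mem_monomialSpan, RingHom.mem_ker, constantCoeff_eq, ← notMem_support_iff]
    simp only [Set.mem_insert_iff, Set.mem_singleton_iff, exists_eq_or_imp, exists_eq_left,
      expo_le_iff]
    constructor
    · intro h h0
      simpa using h 0 h0
    · intro h e he
      by_contra hne
      apply h
      have : e = 0 := by
        rw [Finsupp.ext_iff, Fin.forall_fin_succ, Fin.forall_fin_two]
        refine ⟨?_, ?_, ?_⟩
        · change e 0 = 0
          omega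
        · change e 1 = 0
          omega
        · change e 2 = 0
          omega
      rwa [← this]
  rw [h]
  exact RingHom.ker_isMaximal_of_surjective _ fun r => ⟨C r, constantCoeff_C _ r⟩

theorem purePowers_le_starMonomialIdeal (n : ℕ) :
    purePowers k 2 (2 * n + 1) (2 * n + 4) ≤ starMonomialIdeal k n := by
  refine Ideal.span_mono ?_
  intro p hp
  simp only [Set.mem_insert_iff, Set.mem_singleton_iff] at hp ⊢
  tauto

theorem starMonomialIdeal_ne_top {n : ℕ} (hn : n ≠ 0) : starMonomialIdeal k n ≠ ⊤ := by
  rw [starMonomialIdeal_eq]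
  exact monomialSpan_ne_top (by simp [zero_eq_expo_iff, hn])

theorem isPerfectIdeal_starMonomialIdeal {n : ℕ} (hn : n ≠ 0) :
    IsPerfectIdeal (starMonomialIdeal k n) := by
  have hle := purePowers_le_starMonomialIdeal (k := k) n
  have hmem : ∀ f ∈ [(X 0 : MvPolynomial (Fin 3) k) ^ 2, X 1 ^ (2 * n + 1), X 2 ^ (2 * n + 4)],
      f ∈ starMonomialIdeal k n := by
    rw [← ofList_purePowers] at hle
    exact fun f hf => hle (Ideal.subset_span hf)
  refine isPerfectIdeal_of_isRegular
    (isRegular_purePowers one_ne_zero one_ne_zero one_ne_zero).1 isMaximal_ofList_variables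
    (starMonomialIdeal_ne_top hn) ?_
    (isRegular_purePowers (k := k) (a := 2) (b := 2 * n + 1) (c := 2 * n + 4) (by omega)
      (by omega) (by omega)) hmem rfl
  simp only [List.forall_mem_cons] at hmem
  refine Ideal.span_le.2 fun f hf => ?_
  simp only [List.mem_cons, List.not_mem_nil, or_false, pow_one] at hf
  rcases hf with rfl | rfl | rfl
  exacts [⟨_, hmem.1⟩, ⟨_, hmem.2.1⟩, ⟨_, hmem.2.2.1⟩]

/-- The ideals of the chain that links the monomial ideal to `(x, y^{n-2}, z^n)`. -/
noncomputable def linkChain (k : Type*) [Field k] (n : ℕ) : Fin 5 → Ideal (MvPolynomial (Fin 3) k) :=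
  ![monomialSpan k {expo 2 0 0, expo 0 (2 * n + 1) 0,
      expo 0 0 (2 * n + 4), expo 0 n 1, expo 1 (n - 1) 1, expo 1 1 (n + 1)},
    monomialSpan k {expo 2 0 0, expo 0 (2 * n) 0, expo 0 0 (2 * n + 3), expo 1 (n + 1) 0,
      expo 0 (n + 2) (n + 3)},
    monomialSpan k {expo 2 0 0, expo 0 (n - 1) 0, expo 0 0 (2 * n + 3), expo 1 (n - 2) 0,
      expo 1 0 n},
    monomialSpan k {expo 1 0 0, expo 0 (n - 1) 0, expo 0 0 (2 * n + 3), expo 0 1 (n + 3)},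
    monomialSpan k {expo 1 0 0, expo 0 (n - 2) 0, expo 0 0 n}]

/-- Both colon conditions unfold to linear inequalities in the three exponents of a monomial, which
`omega` decides. The other three links are checked in the same way. -/
theorem isDirectlyLinkedBy_linkChain_zero {n : ℕ} (hn : 4 ≤ n) :
    IsDirectlyLinkedBy (purePowers k 2 (2 * n + 1) (2 * n + 4))
      (linkChain k n 0) (linkChain k n 1) := by
  rw [purePowers_eq]
  refine isDirectlyLinkedBy_monomialSpan ?_ ?_ ?_ ?_
  · simp [zero_eq_expo_iff]
  · simp [zero_eq_expo_iff]; omega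
  all_goals
    intro e
    simp only [Set.mem_insert_iff, Set.mem_singleton_iff, exists_eq_or_imp, exists_eq_left,
      forall_eq_or_imp, forall_eq, expo_le_iff, Finsupp.add_apply, expo_apply_zero,
      expo_apply_one, expo_apply_two]
    generalize e 0 = a
    generalize e 1 = b
    generalize e 2 = c
    omega

theorem isDirectlyLinkedBy_linkChain_one {n : ℕ} (hn : 4 ≤ n) :
    IsDirectlyLinkedBy (purePowers k 2 (2 * n) (2 * n + 3))
      (linkChain k n 1) (linkChain k n 2) := by
  rw [purePowers_eq]
  refine isDirectlyLinkedBy_monomialSpan ?_ ?_ ?_ ?_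
  · simp [zero_eq_expo_iff]; omega
  · simp [zero_eq_expo_iff]; omega
  all_goals
    intro e
    simp only [Set.mem_insert_iff, Set.mem_singleton_iff, exists_eq_or_imp, exists_eq_left,
      forall_eq_or_imp, forall_eq, expo_le_iff, Finsupp.add_apply, expo_apply_zero,
      expo_apply_one, expo_apply_two]
    generalize e 0 = a
    generalize e 1 = b
    generalize e 2 = c
    omega

theorem isDirectlyLinkedBy_linkChain_two {n : ℕ} (hn : 4 ≤ n) :
    IsDirectlyLinkedBy (purePowers k 2 (n - 1) (2 * n + 3))
      (linkChain k n 2) (linkChain k n 3) := by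
  rw [purePowers_eq]
  refine isDirectlyLinkedBy_monomialSpan ?_ ?_ ?_ ?_
  · simp [zero_eq_expo_iff]; omega
  · simp [zero_eq_expo_iff]; omega
  all_goals
    intro e
    simp only [Set.mem_insert_iff, Set.mem_singleton_iff, exists_eq_or_imp, exists_eq_left,
      forall_eq_or_imp, forall_eq, expo_le_iff, Finsupp.add_apply, expo_apply_zero,
      expo_apply_one, expo_apply_two]
    generalize e 0 = a
    generalize e 1 = b
    generalize e 2 = c
    omega

theorem isDirectlyLinkedBy_linkChain_three {n : ℕ} (hn : 4 ≤ n) :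
    IsDirectlyLinkedBy (purePowers k 1 (n - 1) (2 * n + 3))
      (linkChain k n 3) (linkChain k n 4) := by
  rw [purePowers_eq]
  refine isDirectlyLinkedBy_monomialSpan ?_ ?_ ?_ ?_
  · simp [zero_eq_expo_iff]; omega
  · simp [zero_eq_expo_iff]; omega
  all_goals
    intro e
    simp only [Set.mem_insert_iff, Set.mem_singleton_iff, exists_eq_or_imp, exists_eq_left,
      forall_eq_or_imp, forall_eq, expo_le_iff, Finsupp.add_apply, expo_apply_zero,
      expo_apply_one, expo_apply_two]
    generalize e 0 = a
    generalize e 1 = b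
    generalize e 2 = c
    omega

theorem linkChain_last (n : ℕ) : linkChain k n 4 = purePowers k 1 (n - 2) n :=
  (purePowers_eq 1 (n - 2) n).symm

theorem isSequentiallyBoundedChain_linkChain {n : ℕ} (hn : 4 ≤ n) :
    IsSequentiallyBoundedChain 4 (linkChain k n)
      ![purePowers k 2 (2 * n + 1) (2 * n + 4), purePowers k 2 (2 * n) (2 * n + 3),
        purePowers k 2 (n - 1) (2 * n + 3), purePowers k 1 (n - 1) (2 * n + 3)]
      ![[2, 2 * n + 1, 2 * n + 4], [2, 2 * n, 2 * n + 3],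
        [2, n - 1, 2 * n + 3], [1, n - 1, 2 * n + 3]] := by
  refine ⟨fun i => ?_, fun i j hij => ?_, [1, n - 2, n], ?_⟩
  · fin_cases i
    · exact ⟨isHomogeneousCI_purePowers (by omega) (by omega) (by omega),
        isDirectlyLinkedBy_linkChain_zero hn⟩
    · exact ⟨isHomogeneousCI_purePowers (by omega) (by omega) (by omega),
        isDirectlyLinkedBy_linkChain_one hn⟩
    · exact ⟨isHomogeneousCI_purePowers (by omega) (by omega) (by omega),
        isDirectlyLinkedBy_linkChain_two hn⟩
    · exact ⟨isHomogeneousCI_purePowers (by omega) (by omega) (by omega),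
        isDirectlyLinkedBy_linkChain_three hn⟩
  · fin_cases i <;> fin_cases j <;> (simp at hij ⊢; try omega)
  · change IsHomogeneousCI (linkChain k n 4) _
    rw [linkChain_last]
    exact isHomogeneousCI_purePowers (by omega) (by omega) (by omega)

theorem isMonomialIdeal_linkChain (n : ℕ) (i : Fin 5) : IsMonomialIdeal (linkChain k n i) := by
  fin_cases i <;> exact isMonomialIdeal_monomialSpan _

end ThreeVariables

/-! ### Hilbert function from a graded free resolution -/

section HilbertFunction

variable {σ k : Type*} [Field k]

/-- The rank-nullity formula for the restriction of a linear map to a submodule. -/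
theorem finrank_map_add_finrank_inf_ker {V W : Type*} [AddCommGroup V] [Module k V]
    [AddCommGroup W] [Module k W] (f : V →ₗ[k] W) (A : Submodule k V) [Module.Finite k A] :
    Module.finrank k (A.map f) + Module.finrank k (A ⊓ LinearMap.ker f : Submodule k V) =
      Module.finrank k A := by
  have h := (f.domRestrict A).finrank_range_add_finrank_ker
  rw [LinearMap.range_domRestrict, LinearMap.ker_domRestrict] at h
  rw [← h, ← Submodule.map_comap_subtype, Submodule.finrank_map_subtype_eq]

/-- The forms of degree `j` in the graded module `R(-s)`. -/
noncomputable def shiftedPiece (σ k : Type*) [Field k] (s j : ℕ) : Submodule k (MvPolynomial σ k) :=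
  -- Without the case split, truncated subtraction would put the constants in every degree below
  -- `s`.
  if s ≤ j then homogeneousSubmodule σ k (j - s) else ⊥

/-- The projection of `R(-s)` to its component of degree `j`. -/
noncomputable def shiftedComponent (s j : ℕ) : MvPolynomial σ k →ₗ[k] MvPolynomial σ k :=
  if s ≤ j then homogeneousComponent (j - s) else 0

theorem shiftedComponent_mem (s j : ℕ) (p : MvPolynomial σ k) :
    shiftedComponent s j p ∈ shiftedPiece σ k s j := by
  unfold shiftedComponent shiftedPiece
  split_ifs
  · exact homogeneousComponent_mem _ _
  · simp

theorem shiftedComponent_eq_self {s j : ℕ} {p : MvPolynomial σ k}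
    (hp : p ∈ shiftedPiece σ k s j) : shiftedComponent s j p = p := by
  unfold shiftedComponent
  unfold shiftedPiece at hp
  split_ifs at hp ⊢
  · exact homogeneousComponent_eq_self hp
  · simpa using hp.symm

theorem homogeneousComponent_mul_of_isHomogeneous {r : MvPolynomial σ k} {d : ℕ}
    (hr : r.IsHomogeneous d) (n : ℕ) (p : MvPolynomial σ k) :
    homogeneousComponent n (r * p) = if d ≤ n then r * homogeneousComponent (n - d) p else 0 := by
  have h := DirectSum.coe_decompose_mul_of_left_mem (homogeneousSubmodule σ k) (a := r) (b := p)
    n hr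
  have hd : ∀ (q : MvPolynomial σ k) (i : ℕ),
      (DirectSum.decompose (homogeneousSubmodule σ k) q i : MvPolynomial σ k) =
        homogeneousComponent i q := decomposition.decompose'_apply
  rwa [hd, hd] at h

/-- Multiplication by a form of degree t - s is a degree-zero map R(-t) → R(-s), so it commutes with
taking components. The alternative `r = 0` covers the entries with t < s. -/
theorem shiftedComponent_mul {s t : ℕ} {r : MvPolynomial σ k}
    (hr : r = 0 ∨ ∃ d, s + d = t ∧ r.IsHomogeneous d) (j : ℕ) (p : MvPolynomial σ k) :
    shiftedComponent s j (r * p) = r * shiftedComponent t j p := by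
  obtain rfl | ⟨d, rfl, hr⟩ := hr
  · simp
  unfold shiftedComponent
  by_cases h : s ≤ j
  · rw [if_pos h, homogeneousComponent_mul_of_isHomogeneous hr]
    by_cases h' : d ≤ j - s
    · rw [if_pos h', if_pos (by omega), Nat.sub_sub]
    · rw [if_neg h', if_neg (by omega), LinearMap.zero_apply, mul_zero]
  · rw [if_neg h, if_neg (by omega), LinearMap.zero_apply, LinearMap.zero_apply, mul_zero]

/-- The component of degree `j` of the graded free module with shifts `s`. -/
noncomputable def gradedPiece {α : Type*} (σ k : Type*) [Field k] (s : α → ℕ) (j : ℕ) :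
    Submodule k (α → MvPolynomial σ k) :=
  Submodule.pi Set.univ fun a => shiftedPiece σ k (s a) j

theorem mem_gradedPiece {α : Type*} {s : α → ℕ} {j : ℕ} {v : α → MvPolynomial σ k} :
    v ∈ gradedPiece σ k s j ↔ ∀ a, v a ∈ shiftedPiece σ k (s a) j := by
  simp [gradedPiece, Submodule.mem_pi]

/-- A graded piece of a graded free module is the product of the pieces of its summands. -/
noncomputable def gradedPieceEquiv {α : Type*} (σ k : Type*) [Field k] (s : α → ℕ) (j : ℕ) :
    gradedPiece σ k s j ≃ₗ[k] ∀ a, shiftedPiece σ k (s a) j where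
  toFun v a := ⟨v.1 a, mem_gradedPiece.1 v.2 a⟩
  invFun w := ⟨fun a => w a, mem_gradedPiece.2 fun a => (w a).2⟩
  map_add' _ _ := rfl
  map_smul' _ _ := rfl
  left_inv _ := rfl
  right_inv _ := rfl

instance [Finite σ] (s j : ℕ) : Module.Finite k (shiftedPiece σ k s j) := by
  refine Module.Finite.of_fg ?_
  unfold shiftedPiece
  split_ifs
  · exact homogeneousSubmodule_fg σ k _
  · exact Submodule.fg_bot

instance [Finite σ] (j : ℕ) : Module.Finite k (homogeneousSubmodule σ k j) :=
  Module.Finite.of_fg (homogeneousSubmodule_fg σ k _)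

instance [Finite σ] {α : Type*} [Finite α] (s : α → ℕ) (j : ℕ) :
    Module.Finite k (gradedPiece σ k s j) :=
  Module.Finite.equiv (gradedPieceEquiv σ k s j).symm

theorem finrank_gradedPiece [Finite σ] {α : Type*} [Fintype α] (s : α → ℕ) (j : ℕ) :
    Module.finrank k (gradedPiece σ k s j) =
      ∑ a, Module.finrank k (shiftedPiece σ k (s a) j) := by
  rw [(gradedPieceEquiv σ k s j).finrank_eq, Module.finrank_pi_fintype]

/-- The image of a graded piece under a homogeneous matrix is the graded piece of the image. -/
theorem map_gradedPiece {α β : Type*} [Fintype β] {s : α → ℕ} {t : β → ℕ}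
    (M : Matrix α β (MvPolynomial σ k))
    (hM : ∀ a b, M a b = 0 ∨ ∃ d, s a + d = t b ∧ (M a b).IsHomogeneous d) (j : ℕ) :
    (gradedPiece σ k t j).map (M.mulVecLin.restrictScalars k) =
      gradedPiece σ k s j ⊓ (LinearMap.range (M.mulVecLin.restrictScalars k)) := by
  -- The matrix commutes with projection to degree `j`, so any preimage of a vector of degree `j`
  -- may be replaced by its component of degree `j`.
  have key : ∀ w : β → MvPolynomial σ k, ∀ a, shiftedComponent (s a) j (M.mulVec w a) =
      M.mulVec (fun b => shiftedComponent (t b) j (w b)) a := by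
    intro w a
    simp only [Matrix.mulVec, dotProduct, map_sum]
    exact Finset.sum_congr rfl fun b _ => shiftedComponent_mul (hM a b) j (w b)
  ext v
  simp only [Submodule.mem_map, Submodule.mem_inf, LinearMap.mem_range,
    LinearMap.restrictScalars_apply, Matrix.mulVecLin_apply]
  constructor
  · rintro ⟨w, hw, rfl⟩
    refine ⟨mem_gradedPiece.2 fun a => ?_, w, rfl⟩
    have hw' : (fun b => shiftedComponent (t b) j (w b)) = w :=
      funext fun b => shiftedComponent_eq_self (mem_gradedPiece.1 hw b)
    have := shiftedComponent_mem (s a) j (M.mulVec w a)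
    rwa [key, hw'] at this
  · rintro ⟨hv, w, rfl⟩
    refine ⟨fun b => shiftedComponent (t b) j (w b),
      mem_gradedPiece.2 fun b => shiftedComponent_mem _ _ _, funext fun a => ?_⟩
    rw [← key]
    exact shiftedComponent_eq_self (mem_gradedPiece.1 hv a)

/-- The dimension of the space of forms of degree `j` in `R(-s)`. -/
noncomputable def shiftedDim (σ k : Type*) [Field k] (s j : ℕ) : ℕ :=
  Module.finrank k (shiftedPiece σ k s j)

theorem hilbertFun_add_finrank [Finite σ] (I : Ideal (MvPolynomial σ k)) (j : ℕ) :
    hilbertFun I j + Module.finrank k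
      (homogeneousSubmodule σ k j ⊓ I.restrictScalars k : Submodule k (MvPolynomial σ k)) =
      Module.finrank k (homogeneousSubmodule σ k j) := by
  have h : I.restrictScalars k = LinearMap.ker (Ideal.Quotient.mkₐ k I).toLinearMap := by
    ext p
    simp [Ideal.Quotient.eq_zero_iff_mem]
  rw [h]
  exact finrank_map_add_finrank_inf_ker _ _

/-- The dimension count for a graded free resolution that has length at most three. -/
theorem hilbertFun_eq_of_resolution [Finite σ] {I : Ideal (MvPolynomial σ k)}
    (F : MinimalGradedFreeResolution I) (h3 : F.rank 3 = 0) (j : ℕ) :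
    (hilbertFun I j : ℤ) = shiftedDim σ k 0 j - ∑ a, (shiftedDim σ k (F.shift 0 a) j : ℤ)
      + ∑ a, (shiftedDim σ k (F.shift 1 a) j : ℤ)
      - ∑ a, (shiftedDim σ k (F.shift 2 a) j : ℤ) := by
  -- Written as a matrix with one row, the map F₁ → R falls under `map_gradedPiece` too. Below, `G
  -- i` is the degree-`j` piece of F_{i+1}.
  let g : Matrix (Fin 1) (Fin (F.rank 0)) (MvPolynomial σ k) := fun _ b => F.gen b
  let G := fun i => gradedPiece σ k (F.shift i) j
  have hdiff : ∀ i, (G (i + 1)).map ((F.diff i).mulVecLin.restrictScalars k) =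
      G i ⊓ LinearMap.range ((F.diff i).mulVecLin.restrictScalars k) :=
    fun i => map_gradedPiece (F.diff i) (F.diff_homogeneous i) j
  have hker : ∀ i, LinearMap.ker ((F.diff i).mulVecLin.restrictScalars k) =
      LinearMap.range ((F.diff (i + 1)).mulVecLin.restrictScalars k) := by
    intro i
    ext v
    simpa using F.exact_succ i v
  have hg : (G 0).map (g.mulVecLin.restrictScalars k) =
      gradedPiece σ k (fun _ => 0) j ⊓ LinearMap.range (g.mulVecLin.restrictScalars k) := by
    refine map_gradedPiece g (fun a b => Or.inr ⟨_, zero_add _, F.gen_homogeneous b⟩) j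
  have hkerg : LinearMap.ker (g.mulVecLin.restrictScalars k) =
      LinearMap.range ((F.diff 0).mulVecLin.restrictScalars k) := by
    ext v
    have : g.mulVec v = 0 ↔ ∑ a, v a * F.gen a = 0 := by
      rw [funext_iff]
      simp [g, Matrix.mulVec, dotProduct, mul_comm]
    simpa [this] using F.exact_zero v
  have e0 : Module.finrank k ((G 0).map (g.mulVecLin.restrictScalars k)) =
      Module.finrank k (homogeneousSubmodule σ k j ⊓ I.restrictScalars k :
        Submodule k (MvPolynomial σ k)) := by
    rw [hg]
    let e := (LinearEquiv.funUnique (Fin 1) k (MvPolynomial σ k))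
    have : (homogeneousSubmodule σ k j ⊓ I.restrictScalars k) =
        (gradedPiece σ k (fun _ : Fin 1 => 0) j ⊓
          LinearMap.range (g.mulVecLin.restrictScalars k)).map e.toLinearMap := by
      ext p
      rw [Submodule.mem_map_equiv, Submodule.mem_inf, Submodule.mem_inf, mem_gradedPiece,
        Submodule.restrictScalars_mem]
      refine and_congr ?_ ?_
      · simp [shiftedPiece, e]
      · conv_lhs => rw [← F.span_gen]
        rw [Ideal.mem_span_range_iff_exists_fun]
        simp only [LinearMap.mem_range, LinearMap.restrictScalars_apply, Matrix.mulVecLin_apply]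
        refine exists_congr fun c => ?_
        rw [funext_iff]
        simp [g, Matrix.mulVec, dotProduct, mul_comm, e]
    rw [this]
    exact (e.submoduleMap _).finrank_eq
  have e1 := hilbertFun_add_finrank I j
  have e2 := finrank_map_add_finrank_inf_ker (g.mulVecLin.restrictScalars k) (G 0)
  have e3 : Module.finrank k ((G 1).map ((F.diff 0).mulVecLin.restrictScalars k)) +
      Module.finrank k ((G 2).map ((F.diff 1).mulVecLin.restrictScalars k)) =
        Module.finrank k (G 1) := by
    rw [← finrank_map_add_finrank_inf_ker ((F.diff 0).mulVecLin.restrictScalars k) (G 1),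
      hker, ← hdiff]
  have e4 : Module.finrank k ((G 2).map ((F.diff 1).mulVecLin.restrictScalars k)) +
      Module.finrank k ((G 3).map ((F.diff 2).mulVecLin.restrictScalars k)) =
        Module.finrank k (G 2) := by
    rw [← finrank_map_add_finrank_inf_ker ((F.diff 1).mulVecLin.restrictScalars k) (G 2),
      hker, ← hdiff]
  rw [hkerg, ← hdiff] at e2
  change _ + Module.finrank k ((G 1).map ((F.diff 0).mulVecLin.restrictScalars k)) = _ at e2
  -- F₄ = 0 ends the telescoping of the rank-nullity identities `e1` to `e4`.
  have e5 : Module.finrank k ((G 3).map ((F.diff 2).mulVecLin.restrictScalars k)) = 0 := by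
    refine Nat.eq_zero_of_le_zero ((Submodule.finrank_map_le _ _).trans ?_)
    rw [finrank_gradedPiece]
    have : IsEmpty (Fin (F.rank 3)) := by rw [h3]; infer_instance
    simp
  have h0 : shiftedDim σ k 0 j = Module.finrank k (homogeneousSubmodule σ k j) := by
    rw [shiftedDim, shiftedPiece, if_pos (Nat.zero_le j), Nat.sub_zero]
  have hG : ∀ i, (Module.finrank k (G i) : ℤ) = ∑ a, (shiftedDim σ k (F.shift i a) j : ℤ) := by
    intro i
    simp only [G, shiftedDim]
    rw [finrank_gradedPiece]
    push_cast
    rfl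
  rw [← hG 0, ← hG 1, ← hG 2, h0]
  omega

/-- A multiset is determined by its multiplicities. This turns sums over the basis of the resolution
into sums over the table, and shows that F₄ = 0. -/
theorem sum_shift_eq {I : Ideal (MvPolynomial σ k)} (F : MinimalGradedFreeResolution I) {n : ℕ}
    (hF : ∀ i j, F.betti i j = (starShifts n i).count j) (i : ℕ) :
    Finset.univ.val.map (F.shift i) = starShifts n (i + 1) := by
  ext j
  rw [← hF, Multiset.count_map, MinimalGradedFreeResolution.betti]
  simp [Finset.card_def, eq_comm]

end HilbertFunction

/-! ### Comparison of the two Hilbert series -/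

section HilbertSeries

variable {k : Type*} [Field k]

theorem finrank_supported {M : Type*} (A : Set M) :
    Module.finrank k (AddMonoidAlgebra.supported k k A) = A.ncard := by
  rw [(AddMonoidAlgebra.supportedEquivFinsupp (R := k) (S := k) A).finrank_eq,
    Module.finrank_eq_nat_card_basis (Finsupp.basisSingleOne (R := k) (ι := A)),
    Nat.card_coe_set_eq]

theorem finite_setOf_degree_eq {σ : Type*} [Finite σ] (j : ℕ) :
    {e : σ →₀ ℕ | e.degree = j}.Finite := by
  classical
  have := Fintype.ofFinite σ
  refine (Finset.finite_toSet (Finset.finsuppAntidiag Finset.univ j)).subset fun e he => ?_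
  simpa [Finset.mem_finsuppAntidiag, Finsupp.degree_eq_sum] using he

/-- The Hilbert function of a monomial ideal counts the standard monomials. -/
theorem hilbertFun_monomialSpan {σ : Type*} [Finite σ] (S : Set (σ →₀ ℕ)) (j : ℕ) :
    hilbertFun (monomialSpan k S) j = {e : σ →₀ ℕ | e.degree = j ∧ ¬ ∃ s ∈ S, s ≤ e}.ncard := by
  have h := hilbertFun_add_finrank (monomialSpan k S) j
  have h1 : (homogeneousSubmodule σ k j ⊓ (monomialSpan k S).restrictScalars k) =
      AddMonoidAlgebra.supported k k {e : σ →₀ ℕ | e.degree = j ∧ ∃ s ∈ S, s ≤ e} := by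
    ext p
    rw [Submodule.mem_inf, Submodule.restrictScalars_mem, mem_monomialSpan,
      homogeneousSubmodule_eq_finsupp_supported]
    exact ⟨fun hp e he => ⟨hp.1 he, hp.2 e he⟩, fun hp => ⟨fun e he => (hp he).1,
      fun e he => (hp he).2⟩⟩
  rw [h1, homogeneousSubmodule_eq_finsupp_supported, finrank_supported, finrank_supported] at h
  have hfin := finite_setOf_degree_eq (σ := σ) j
  have h2 := Set.ncard_inter_add_ncard_sdiff_eq_ncard {e : σ →₀ ℕ | e.degree = j}
    {e | ∃ s ∈ S, s ≤ e} hfin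
  have h3 : {e : σ →₀ ℕ | e.degree = j} \ {e | ∃ s ∈ S, s ≤ e} =
    {e : σ →₀ ℕ | e.degree = j ∧ ¬ ∃ s ∈ S, s ≤ e} := rfl
  have h4 : {e : σ →₀ ℕ | e.degree = j} ∩ {e | ∃ s ∈ S, s ≤ e} =
    {e : σ →₀ ℕ | e.degree = j ∧ ∃ s ∈ S, s ≤ e} := rfl
  rw [h3, h4] at h2
  omega

theorem finrank_homogeneousSubmodule_fin_three (j : ℕ) :
    Module.finrank k (homogeneousSubmodule (Fin 3) k j) = (2 + j).choose 2 := by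
  rw [homogeneousSubmodule_eq_finsupp_supported, finrank_supported]
  have h : {e : Fin 3 →₀ ℕ | e.degree = j} =
      (Finset.finsuppAntidiag (Finset.univ : Finset (Fin 3)) j : Set (Fin 3 →₀ ℕ)) := by
    ext e
    simp [Finset.mem_finsuppAntidiag, Finsupp.degree_eq_sum]
  rw [h, Set.ncard_coe_finset, Finset.card_finsuppAntidiag_nat_eq_choose, Finset.card_univ,
    Fintype.card_fin, show 3 + j - 1 = 2 + j by omega, Nat.choose_symm_add]

/-- The series of R is 1/(1 - X)^3, and the twist R(-s) multiplies it by X^s. -/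
theorem coe_shiftedDim (s j : ℕ) :
    (shiftedDim (Fin 3) k s j : ℤ) = PowerSeries.coeff j ((PowerSeries.X : PowerSeries ℤ) ^ s *
      PowerSeries.mk fun n => ((2 + n).choose 2 : ℤ)) := by
  rw [PowerSeries.coeff_X_pow_mul', PowerSeries.coeff_mk, shiftedDim]
  by_cases h : s ≤ j
  · rw [if_pos h, shiftedPiece, if_pos h, finrank_homogeneousSubmodule_fin_three]
  · rw [if_neg h, shiftedPiece, if_neg h, finrank_bot, Nat.cast_zero]

/-- The Hilbert series of an ideal with the Betti table `(⋆)`. -/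
theorem hilbertSeries_mul_of_satisfiesStar {n : ℕ} {J : Ideal (MvPolynomial (Fin 3) k)}
    (hJ : SatisfiesStar n J) :
    (PowerSeries.mk fun j => (hilbertFun J j : ℤ)) * (1 - PowerSeries.X) ^ 3 =
      1 - ((starShifts n 1).map fun s => (PowerSeries.X : PowerSeries ℤ) ^ s).sum
        + ((starShifts n 2).map fun s => (PowerSeries.X : PowerSeries ℤ) ^ s).sum
        - ((starShifts n 3).map fun s => (PowerSeries.X : PowerSeries ℤ) ^ s).sum := by
  obtain ⟨F, hF⟩ := hJ.2
  have h3 : F.rank 3 = 0 := by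
    have := congrArg Multiset.card (sum_shift_eq F hF 3)
    simpa [starShifts] using this
  have hsum : ∀ i, ((starShifts n (i + 1)).map fun s => (PowerSeries.X : PowerSeries ℤ) ^ s).sum =
      ∑ a, (PowerSeries.X : PowerSeries ℤ) ^ F.shift i a := by
    intro i
    rw [← sum_shift_eq F hF i, Multiset.map_map]
    rfl
  have hmk : (PowerSeries.mk fun n => ((2 + n).choose 2 : ℤ)) * (1 - PowerSeries.X) ^ 3 = 1 :=
    PowerSeries.mk_add_choose_mul_one_sub_pow_eq_one ℤ 2
  rw [hsum 0, hsum 1, hsum 2]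
  have key : (PowerSeries.mk fun j => (hilbertFun J j : ℤ)) =
      (1 - ∑ a, (PowerSeries.X : PowerSeries ℤ) ^ F.shift 0 a
        + ∑ a, (PowerSeries.X : PowerSeries ℤ) ^ F.shift 1 a
        - ∑ a, (PowerSeries.X : PowerSeries ℤ) ^ F.shift 2 a) *
      PowerSeries.mk fun n => ((2 + n).choose 2 : ℤ) := by
    ext j
    rw [PowerSeries.coeff_mk, hilbertFun_eq_of_resolution F h3]
    simp only [coe_shiftedDim, sub_mul, add_mul, Finset.sum_mul, map_sub, map_add, map_sum,
      pow_zero]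
  rw [key, mul_assoc, hmk, mul_one]

/-- The exponents `(a, b, c)` of the given `a` with `b₁ ≤ b < b₂` and `c < c₂`. -/
def exponentBox (a b₁ b₂ c₂ : ℕ) : Finset (ℕ × ℕ × ℕ) :=
  {a} ×ˢ Finset.Ico b₁ b₂ ×ˢ Finset.range c₂

theorem mem_exponentBox {a b₁ b₂ c₂ : ℕ} {t : ℕ × ℕ × ℕ} :
    t ∈ exponentBox a b₁ b₂ c₂ ↔ t.1 = a ∧ (b₁ ≤ t.2.1 ∧ t.2.1 < b₂) ∧ t.2.2 < c₂ := by
  simp only [exponentBox, Finset.mem_product, Finset.mem_singleton, Finset.mem_Ico,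
    Finset.mem_range]

/-- The sum factors into geometric sums in b and c, each absorbing one factor 1 - x. -/
theorem sum_exponentBox_mul {A : Type*} [CommRing A] (x : A) {a b₁ b₂ c₂ : ℕ} (hb : b₁ ≤ b₂) :
    (∑ t ∈ exponentBox a b₁ b₂ c₂, x ^ (t.1 + t.2.1 + t.2.2)) * (1 - x) ^ 2 =
      x ^ a * (x ^ b₁ - x ^ b₂) * (1 - x ^ c₂) := by
  have h : ∑ t ∈ exponentBox a b₁ b₂ c₂, x ^ (t.1 + t.2.1 + t.2.2) =
      x ^ a * (∑ b ∈ Finset.Ico b₁ b₂, x ^ b) * ∑ c ∈ Finset.range c₂, x ^ c := by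
    simp only [exponentBox, Finset.sum_product, Finset.sum_singleton, pow_add, Finset.mul_sum,
      Finset.sum_mul]
    exact Finset.sum_comm
  rw [h, ← geom_sum_Ico_mul_neg x hb, ← geom_sum_mul_neg x c₂]
  ring

/-- The exponents of the monomials that are not in the monomial ideal. -/
def standardExponents (n : ℕ) : Finset (ℕ × ℕ × ℕ) :=
  -- Since x² lies in the ideal, only the slices a = 0 and a = 1 occur. Each is cut where the bound
  -- on the exponent of z drops.
  (exponentBox 0 0 n (2 * n + 4) ∪ exponentBox 0 n (2 * n + 1) 1) ∪
    (exponentBox 1 0 1 (2 * n + 4) ∪ (exponentBox 1 1 (n - 1) (n + 1) ∪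
      exponentBox 1 (n - 1) (2 * n + 1) 1))

theorem sum_standardExponents {A : Type*} [AddCommMonoid A] {n : ℕ} (hn : 2 ≤ n)
    (f : ℕ × ℕ × ℕ → A) :
    ∑ t ∈ standardExponents n, f t =
      (∑ t ∈ exponentBox 0 0 n (2 * n + 4), f t + ∑ t ∈ exponentBox 0 n (2 * n + 1) 1, f t) +
      (∑ t ∈ exponentBox 1 0 1 (2 * n + 4), f t + (∑ t ∈ exponentBox 1 1 (n - 1) (n + 1), f t +
        ∑ t ∈ exponentBox 1 (n - 1) (2 * n + 1) 1, f t)) := by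
  unfold standardExponents
  rw [Finset.sum_union, Finset.sum_union, Finset.sum_union, Finset.sum_union]
  all_goals
    rw [Finset.disjoint_left]
    intro t h1 h2
    simp only [Finset.mem_union, mem_exponentBox] at h1 h2
    omega

theorem mem_standardExponents {n : ℕ} (hn : 2 ≤ n) (e : Fin 3 →₀ ℕ) :
    (e 0, e 1, e 2) ∈ standardExponents n ↔
      ¬ ∃ s ∈ ({expo 2 0 0, expo 0 (2 * n + 1) 0, expo 0 0 (2 * n + 4), expo 0 n 1,
        expo 1 (n - 1) 1, expo 1 1 (n + 1)} : Set (Fin 3 →₀ ℕ)), s ≤ e := by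
  simp only [Set.mem_insert_iff, Set.mem_singleton_iff, exists_eq_or_imp, exists_eq_left,
    expo_le_iff, standardExponents, Finset.mem_union, mem_exponentBox]
  generalize e 0 = a
  generalize e 1 = b
  generalize e 2 = c
  omega

theorem hilbertFun_starMonomialIdeal {n : ℕ} (hn : 2 ≤ n) (j : ℕ) :
    hilbertFun (starMonomialIdeal k n) j =
      ((standardExponents n).filter fun t => t.1 + t.2.1 + t.2.2 = j).card := by
  rw [starMonomialIdeal_eq, hilbertFun_monomialSpan, ← Set.ncard_coe_finset]
  have hdeg : ∀ e : Fin 3 →₀ ℕ, e.degree = e 0 + e 1 + e 2 := fun e => by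
    rw [Finsupp.degree_eq_sum, Fin.sum_univ_three]
  refine Set.ncard_congr (fun e _ => (e 0, e 1, e 2)) ?_ ?_ ?_
  · intro e he
    exact Finset.mem_coe.2 (Finset.mem_filter.2
      ⟨(mem_standardExponents hn e).2 he.2, (hdeg e).symm.trans he.1⟩)
  · intro e e' _ _ h
    simp only [Prod.mk.injEq] at h
    rw [Finsupp.ext_iff, Fin.forall_fin_succ, Fin.forall_fin_two]
    exact h
  · rintro ⟨a, b, c⟩ ht
    have ht' := Finset.mem_filter.1 (Finset.mem_coe.1 ht)
    exact ⟨expo a b c, ⟨(hdeg _).trans ht'.2, (mem_standardExponents hn (expo a b c)).1 ht'.1⟩,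
      rfl⟩

/-- The Hilbert series of the monomial ideal. -/
theorem hilbertSeries_mul_starMonomialIdeal {n : ℕ} (hn : 2 ≤ n) :
    (PowerSeries.mk fun j => (hilbertFun (starMonomialIdeal k n) j : ℤ)) *
        (1 - PowerSeries.X) ^ 3 =
      1 - ((starShifts n 1).map fun s => (PowerSeries.X : PowerSeries ℤ) ^ s).sum
        + ((starShifts n 2).map fun s => (PowerSeries.X : PowerSeries ℤ) ^ s).sum
        - ((starShifts n 3).map fun s => (PowerSeries.X : PowerSeries ℤ) ^ s).sum := by
  have h : (PowerSeries.mk fun j => (hilbertFun (starMonomialIdeal k n) j : ℤ)) =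
      ∑ t ∈ standardExponents n, (PowerSeries.X : PowerSeries ℤ) ^ (t.1 + t.2.1 + t.2.2) := by
    ext j
    rw [PowerSeries.coeff_mk, hilbertFun_starMonomialIdeal hn, map_sum, Finset.card_filter]
    push_cast
    refine Finset.sum_congr rfl fun t _ => ?_
    rw [PowerSeries.coeff_X_pow]
    exact if_congr eq_comm rfl rfl
  -- One factor 1 - X is set apart, because each box absorbs only two of the three.
  rw [h, sum_standardExponents hn, pow_succ, ← mul_assoc]
  simp only [add_mul _ _ (((1 : PowerSeries ℤ) - PowerSeries.X) ^ 2)]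
  rw [sum_exponentBox_mul _ (by omega), sum_exponentBox_mul _ (by omega),
    sum_exponentBox_mul _ (by omega), sum_exponentBox_mul _ (by omega),
    sum_exponentBox_mul _ (by omega)]
  -- This removes the truncated `n - 1` from the exponents, so that `ring` can compare them.
  obtain ⟨m, rfl⟩ : ∃ m, n = m + 1 := ⟨n - 1, by omega⟩
  simp only [starShifts, Multiset.insert_eq_cons, Multiset.map_cons, Multiset.sum_cons,
    Multiset.map_singleton, Multiset.sum_singleton, Nat.add_sub_cancel]
  ring

/-- Both series have the same product with (1 - X)^3, which is invertible and can be cancelled. -/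
theorem hilbertFun_starMonomialIdeal_eq {n : ℕ} (hn : 2 ≤ n)
    {J : Ideal (MvPolynomial (Fin 3) k)} (hJ : SatisfiesStar n J) (j : ℕ) :
    hilbertFun (starMonomialIdeal k n) j = hilbertFun J j := by
  have hmk : (PowerSeries.mk fun n => ((2 + n).choose 2 : ℤ)) * (1 - PowerSeries.X) ^ 3 = 1 :=
    PowerSeries.mk_add_choose_mul_one_sub_pow_eq_one ℤ 2
  have h := (hilbertSeries_mul_starMonomialIdeal (k := k) hn).trans
    (hilbertSeries_mul_of_satisfiesStar hJ).symm
  have h' := congrArg (PowerSeries.coeff j)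
    (mul_right_cancel₀ (right_ne_zero_of_mul_eq_one hmk) h)
  rw [PowerSeries.coeff_mk, PowerSeries.coeff_mk] at h'
  exact_mod_cast h'

end HilbertSeries

theorem theorem5p4 {k : Type*} [Field k] (n : ℕ) (hn : 4 ≤ n)
    (J : Ideal (MvPolynomial (Fin 3) k)) (hJ : SatisfiesStar n J) :
    IsSequentiallyBoundedLicci (starMonomialIdeal k n) ∧
    (∃ L : Fin 5 → Ideal (MvPolynomial (Fin 3) k),
      L 0 = starMonomialIdeal k n ∧ L 4 = purePowers k 1 (n - 2) n ∧
      (∀ i, IsMonomialIdeal (L i)) ∧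
      IsSequentiallyBoundedChain 4 L
        ![purePowers k 2 (2 * n + 1) (2 * n + 4), purePowers k 2 (2 * n) (2 * n + 3),
          purePowers k 2 (n - 1) (2 * n + 3), purePowers k 1 (n - 1) (2 * n + 3)]
        ![[2, 2 * n + 1, 2 * n + 4], [2, 2 * n, 2 * n + 3],
          [2, n - 1, 2 * n + 3], [1, n - 1, 2 * n + 3]]) ∧
    ∀ j : ℕ, hilbertFun (starMonomialIdeal k n) j = hilbertFun J j := by
  have h0 : linkChain k n 0 = starMonomialIdeal k n := (starMonomialIdeal_eq n).symm
  have hchain := isSequentiallyBoundedChain_linkChain (k := k) hn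
  refine ⟨⟨?_, isPerfectIdeal_starMonomialIdeal (by omega), 4, linkChain k n, _, _, h0, hchain⟩,
    ⟨linkChain k n, h0, linkChain_last n, isMonomialIdeal_linkChain n, hchain⟩,
    hilbertFun_starMonomialIdeal_eq (by omega) hJ⟩
  rw [starMonomialIdeal_eq]
  exact isHomogeneous_monomialSpan _
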